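/- Let $A=(a_{ij})$ be an $n\times n$ matrix with entries in $\{0,1\}$, and let $\underline T=(T_1,\dots,T_n)$ be bounded operators on a complex Hilbert space $\mathcal H$ with $\sum_i T_iT_i^*\le I$ and $T_iT_j=a_{ij}T_iT_j$ for all $i,j$ (a contractive $A$-relation tuple). Definitions. For a tuple $\underline R=(R_1,\dots,R_n)$ of bounded operators and a word $\alpha=\alpha_1\cdots\alpha_m$ in the letters $1,\dots,n$, put $\underline R^\alpha=R_{\alpha_1}\cdots R_{\alpha_m}$ (the identity for the empty word). A *minimal dilation* of $\underline T$ is a tuple $\underline R$ on a Hilbert space $\mathcal L\supseteq\mathcal H$ such that $R_i^*h=T_i^*h$ for all $i$ and all $h\in\mathcal H$, and $\overline{\mathrm{span}}\{\underline R^\alpha h:\alpha\text{ a word},\ h\in\mathcal H\}=\mathcal L$. It is a *minimal isometric (standard noncommuting) dilation* if the $R_i$ are isometries with pairwise orthogonal ranges. It is a *minimal Cuntz–Krieger dilation* if the $R_i$ are partial isometries with pairwise orthogonal ranges such that $R_iR_j=a_{ij}R_iR_j$ for all $i,j$ and $R_i^*R_i=I-\sum_{j=1}^n(1-a_{ij})R_jR_j^*$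 for all $i$. For any tuple $\underline R$ on $\mathcal L$, the *maximal $A$-relation subspace* $\mathcal L_A(\underline R)$ is the largest closed subspace $\mathcal M$ of $\mathcal L$ such that $R_i^*\mathcal M\subseteq\mathcal M$ for all $i$ and $(R_iR_j-a_{ij}R_iR_j)^*h=0$ for all $i,j$ and all $h\in\mathcal M$. The *maximal $A$-relation piece* of $\underline R$ is the tuple $\underline R^A$ of the compressions of the $R_i$ to $\mathcal L_A(\underline R)$. Theorem 14. Let $\hat{\underline T}$, acting on $\hat{\mathcal H}\supseteq\mathcal H$, be the minimal isometric dilation of $\underline T$. Then $\mathcal H\subseteq\hat{\mathcal H}_A(\hat{\underline T})$, and the maximal $A$-relation piece $\hat{\underline T}^A$ of $\hat{\underline T}$ is a minimal Cuntz–Krieger dilation of $\underline T$. It is thus a realization of the minimal Cuntz–Krieger dilation: if $\tilde{\underline T}$ on $\tilde{\mathcal H}\supseteq\mathcal H$ is any minimal Cuntz–Krieger dilation of $\underline T$, there is a unitary $U:\tilde{\mathcal H}\to\hat{\mathcal H}_A(\hat{\underline T})$ with $Uh=h$ for all $h\in\mathcal H$ and $U\tilde T_i=\hat T_i^A\,U$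 for all $i$. -/

import Mathlib

open scoped InnerProductSpace

namespace CKDilation

noncomputable section

variable {n : ℕ}

section Tuples

variable {H : Type*} [NormedAddCommGroup H] [InnerProductSpace ℂ H]

/-- The operator `R^α = R_{α₁} ⋯ R_{α_m}` of a word `α`; the empty word gives the identity. -/
def wordOp (R : Fin n → H →L[ℂ] H) (α : List (Fin n)) : H →L[ℂ] H :=
  (α.map R).prod

/-- The value `p(R)` of a polynomial `p` in `n` noncommuting variables at the tuple `R`. -/
def polyEval (R : Fin n → H →L[ℂ] H) (p : FreeAlgebra ℂ (Fin n)) : H →L[ℂ] H :=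
  FreeAlgebra.lift ℂ R p

/-- `A` is a 0-1-matrix. -/
def IsZeroOne (A : Matrix (Fin n) (Fin n) ℂ) : Prop :=
  ∀ i j, A i j = 0 ∨ A i j = 1

/-- The relations `R_i R_j = a_{ij} R_i R_j`. -/
def SatisfiesARelations (A : Matrix (Fin n) (Fin n) ℂ) (R : Fin n → H →L[ℂ] H) : Prop :=
  ∀ i j, R i ∘L R j = A i j • (R i ∘L R j)

/-- The ranges of the `R_i` are pairwise orthogonal. -/
def OrthogonalRanges (R : Fin n → H →L[ℂ] H) : Prop :=
  ∀ i j, i ≠ j → ∀ x y : H, ⟪R i x, R j y⟫_ℂ = 0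

variable [CompleteSpace H]

/-- A contractive tuple (row contraction): `∑ T_i T_i^* ≤ I` in the Loewner order. -/
def IsContractiveTuple (T : Fin n → H →L[ℂ] H) : Prop :=
  ∑ i, T i ∘L (T i).adjoint ≤ ContinuousLinearMap.id ℂ H

/-- A contractive tuple that satisfies the `A`-relations. -/
def IsARelationTuple (A : Matrix (Fin n) (Fin n) ℂ) (T : Fin n → H →L[ℂ] H) : Prop :=
  IsContractiveTuple T ∧ SatisfiesARelations A T

/-- A partial isometry: `V V^* V = V`. -/
def IsPartialIsometry (V : H →L[ℂ] H) : Prop :=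
  V ∘L V.adjoint ∘L V = V

end Tuples

section Dilations

variable {H K : Type*} [NormedAddCommGroup H] [InnerProductSpace ℂ H] [CompleteSpace H]
  [NormedAddCommGroup K] [InnerProductSpace ℂ K] [CompleteSpace K]

/-- `R` on `K` is a dilation of `T` on `H`, where `H` is regarded as a closed subspace of `K`
through the linear isometry `J`: `R_i^* h = T_i^* h` for all `h` in `H`. -/
def IsDilation (T : Fin n → H →L[ℂ] H) (J : H →ₗᵢ[ℂ] K) (R : Fin n → K →L[ℂ] K) : Prop :=
  ∀ i h, (R i).adjoint (J h) = J ((T i).adjoint h)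

/-- A dilation is minimal if the vectors `R^α h` (`α` a word, `h` in `H`) span a dense subspace. -/
def IsMinimalDilation (T : Fin n → H →L[ℂ] H) (J : H →ₗᵢ[ℂ] K) (R : Fin n → K →L[ℂ] K) :
    Prop :=
  IsDilation T J R ∧
    (Submodule.span ℂ {x : K | ∃ (α : List (Fin n)) (h : H), x = wordOp R α (J h)}).topologicalClosure
      = ⊤

/-- The minimal isometric dilation, also called the standard noncommuting dilation:
a minimal dilation that consists of isometries with orthogonal ranges. -/
def IsMinimalIsometricDilation (T : Fin n → H →L[ℂ] H) (J : H →ₗᵢ[ℂ] K)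
    (V : Fin n → K →L[ℂ] K) : Prop :=
  IsMinimalDilation T J V ∧ (∀ i, Isometry (V i)) ∧ OrthogonalRanges V

/-- A minimal Cuntz–Krieger dilation: a minimal dilation that consists of partial isometries with
orthogonal ranges, satisfies the `A`-relations, and satisfies
`R_i^* R_i = I - ∑_j (1 - a_{ij}) R_j R_j^*`. -/
def IsMinimalCuntzKriegerDilation (A : Matrix (Fin n) (Fin n) ℂ) (T : Fin n → H →L[ℂ] H)
    (J : H →ₗᵢ[ℂ] K) (R : Fin n → K →L[ℂ] K) : Prop :=
  IsMinimalDilation T J R ∧ (∀ i, IsPartialIsometry (R i)) ∧ OrthogonalRanges R ∧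
    SatisfiesARelations A R ∧
    ∀ i, (R i).adjoint ∘L R i =
      ContinuousLinearMap.id ℂ K - ∑ j, (1 - A i j) • (R j ∘L (R j).adjoint)

/-- Unitary equivalence of two tuples on spaces containing `H`, by a unitary that
is the identity on `H`. -/
def UnitarilyEquivalentOver {K' : Type*} [NormedAddCommGroup K'] [InnerProductSpace ℂ K']
    (J : H →ₗᵢ[ℂ] K) (R : Fin n → K →L[ℂ] K)
    (J' : H →ₗᵢ[ℂ] K') (R' : Fin n → K' →L[ℂ] K') : Prop :=
  ∃ U : K ≃ₗᵢ[ℂ] K', (∀ h, U (J h) = J' h) ∧ ∀ i x, U (R i x) = R' i (U x)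

end Dilations

section MaximalPiece

variable {K : Type*} [NormedAddCommGroup K] [InnerProductSpace ℂ K] [CompleteSpace K]
  {I : Type*}

/-- The closed subspaces `M` that are invariant under all `R_i^*` and on which all `p_ξ(R)^*`
vanish. -/
def pieceFamily (R : Fin n → K →L[ℂ] K) (p : I → FreeAlgebra ℂ (Fin n)) :
    Set (Submodule ℂ K) :=
  {M | IsClosed (M : Set K) ∧ (∀ i, ∀ h ∈ M, (R i).adjoint h ∈ M) ∧
    ∀ ξ, ∀ h ∈ M, (polyEval R (p ξ)).adjoint h = 0}

/-- The maximal element of `pieceFamily R p`: the closed span of the union of all its members. -/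
def maximalSubspace (R : Fin n → K →L[ℂ] K) (p : I → FreeAlgebra ℂ (Fin n)) :
    Submodule ℂ K :=
  (sSup (pieceFamily R p)).topologicalClosure

/-- It is indeed the greatest member of the family. -/
theorem isGreatest_maximalSubspace (R : Fin n → K →L[ℂ] K) (p : I → FreeAlgebra ℂ (Fin n)) :
    IsGreatest (pieceFamily R p) (maximalSubspace R p) := by
  refine ⟨⟨Submodule.isClosed_topologicalClosure _, ?_, ?_⟩, fun M hM =>
    (le_sSup hM).trans (Submodule.le_topologicalClosure _)⟩
  · intro i
    have h : maximalSubspace R p ≤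
        (maximalSubspace R p).comap ((R i).adjoint : K →ₗ[ℂ] K) := by
      refine Submodule.topologicalClosure_minimal _ (sSup_le fun M hM x hx => ?_)
        ((Submodule.isClosed_topologicalClosure _).preimage (R i).adjoint.continuous)
      exact Submodule.le_topologicalClosure _
        ((le_sSup hM : M ≤ sSup (pieceFamily R p)) (hM.2.1 i x hx))
    exact fun x hx => h hx
  · intro ξ
    have h : maximalSubspace R p ≤ LinearMap.ker ((polyEval R (p ξ)).adjoint : K →ₗ[ℂ] K) := by
      refine Submodule.topologicalClosure_minimal _ (sSup_le fun M hM x hx => ?_)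
        (isClosed_singleton.preimage (polyEval R (p ξ)).adjoint.continuous)
      exact hM.2.2 ξ x hx
    exact fun x hx => h hx

instance maximalSubspace_completeSpace (R : Fin n → K →L[ℂ] K)
    (p : I → FreeAlgebra ℂ (Fin n)) : CompleteSpace (maximalSubspace R p) :=
  (Submodule.isClosed_topologicalClosure _).completeSpace_coe

/-- The maximal piece of `R` with respect to `p`: the compressions `P R_i|` to the maximal
subspace. -/
def maximalPiece (R : Fin n → K →L[ℂ] K) (p : I → FreeAlgebra ℂ (Fin n)) (i : Fin n) :
    maximalSubspace R p →L[ℂ] maximalSubspace R p :=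
  (maximalSubspace R p).orthogonalProjectionOnto ∘L R i ∘L (maximalSubspace R p).subtypeL

/-- The polynomials `z_l z_m - a_{lm} z_l z_m`. -/
def aRelationPoly (A : Matrix (Fin n) (Fin n) ℂ) (lm : Fin n × Fin n) :
    FreeAlgebra ℂ (Fin n) :=
  FreeAlgebra.ι ℂ lm.1 * FreeAlgebra.ι ℂ lm.2 -
    A lm.1 lm.2 • (FreeAlgebra.ι ℂ lm.1 * FreeAlgebra.ι ℂ lm.2)

/-- The maximal `A`-relation subspace of `R`. -/
abbrev maximalASubspace (A : Matrix (Fin n) (Fin n) ℂ) (R : Fin n → K →L[ℂ] K) :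
    Submodule ℂ K :=
  maximalSubspace R (aRelationPoly A)

/-- The maximal `A`-relation piece of `R`. -/
abbrev maximalAPiece (A : Matrix (Fin n) (Fin n) ℂ) (R : Fin n → K →L[ℂ] K) (i : Fin n) :
    maximalASubspace A R →L[ℂ] maximalASubspace A R :=
  maximalPiece R (aRelationPoly A) i

end MaximalPiece

end

end CKDilation

/-! Write `M` for the maximal `A`-relation subspace of the isometric dilation `V`. For `x` in `M`,
the piece acts by `V i` after deleting from `x` its components in the ranges of those `V j` with `A
i j = 0`. The resulting vector stays in `M`, and the deleted terms `V i (V j (V j)^* x)` are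
orthogonal to `M`, because `(V j)^* (V i)^*` vanishes there (`coe_maximalAPiece`). Since the `V i`
are isometries with orthogonal ranges, the Cuntz–Krieger relations follow from this formula.
Minimality passes to `M` because the projection onto a co-invariant subspace intertwines `V` with
its compression.

Uniqueness is a Gram matrix argument: the Cuntz–Krieger relations reduce every inner product of
vectors `R^α a`, `R^β b` to one computed from `T` alone
(`IsMinimalCuntzKriegerDilation.inner_wordOp_eq`). -/

namespace CKDilation

/-! ### Unitaries from equal Gram matrices -/

section Gram

variable {ι E F : Type*} [NormedAddCommGroup E] [InnerProductSpace ℂ E] [CompleteSpace E]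
  [NormedAddCommGroup F] [InnerProductSpace ℂ F] [CompleteSpace F]

/-- Two total families with the same Gram matrix are related by a unitary. -/
theorem exists_linearIsometryEquiv_of_inner_eq (u : ι → E) (v : ι → F)
    (hu : (Submodule.span ℂ (Set.range u)).topologicalClosure = ⊤)
    (hv : (Submodule.span ℂ (Set.range v)).topologicalClosure = ⊤)
    (huv : ∀ i j, ⟪u i, u j⟫_ℂ = ⟪v i, v j⟫_ℂ) :
    ∃ U : E ≃ₗᵢ[ℂ] F, ∀ i, U (u i) = v i := by
  have hdu : DenseRange (Finsupp.linearCombination ℂ u) := by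
    rw [DenseRange, ← LinearMap.coe_range, Finsupp.range_linearCombination]
    exact Submodule.dense_iff_topologicalClosure_eq_top.2 hu
  have hdv : DenseRange (Finsupp.linearCombination ℂ v) := by
    rw [DenseRange, ← LinearMap.coe_range, Finsupp.range_linearCombination]
    exact Submodule.dense_iff_topologicalClosure_eq_top.2 hv
  have hin : ∀ x : ι →₀ ℂ, ⟪Finsupp.linearCombination ℂ v x, Finsupp.linearCombination ℂ v x⟫_ℂ =
      ⟪Finsupp.linearCombination ℂ u x, Finsupp.linearCombination ℂ u x⟫_ℂ := by
    intro x
    simp only [Finsupp.linearCombination_apply, Finsupp.sum, sum_inner, inner_sum,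
      inner_smul_left, inner_smul_right, huv]
  have hnorm : ∀ x : ι →₀ ℂ,
      ‖Finsupp.linearCombination ℂ v (LinearEquiv.refl ℂ (ι →₀ ℂ) x)‖ =
        ‖Finsupp.linearCombination ℂ u x‖ := by
    intro x
    rw [LinearEquiv.refl_apply, @norm_eq_sqrt_re_inner ℂ, hin x, ← @norm_eq_sqrt_re_inner ℂ]
  -- The unitary is the continuous extension of the identity on coefficient vectors, which have the
  -- same norm on both sides.
  refine ⟨(LinearEquiv.refl ℂ (ι →₀ ℂ)).extendOfIsometry _ _ hdu hdv hnorm, fun i => ?_⟩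
  have h := LinearEquiv.extendOfIsometry_eq (LinearEquiv.refl ℂ (ι →₀ ℂ)) _ _ hdu hdv hnorm
    (Finsupp.single i 1)
  simpa using h

end Gram

section Words

variable {n : ℕ} {K : Type*} [NormedAddCommGroup K] [InnerProductSpace ℂ K]

theorem wordOp_nil (R : Fin n → K →L[ℂ] K) (x : K) : wordOp R [] x = x := rfl

theorem wordOp_cons (R : Fin n → K →L[ℂ] K) (i : Fin n) (α : List (Fin n)) (x : K) :
    wordOp R (i :: α) x = R i (wordOp R α x) := by
  simp [wordOp]

end Words

/-! ### Uniqueness of the minimal Cuntz–Krieger dilation -/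

section Uniqueness

variable {n : ℕ} {H K K' : Type*} [NormedAddCommGroup H] [InnerProductSpace ℂ H] [CompleteSpace H]
  [NormedAddCommGroup K] [InnerProductSpace ℂ K] [CompleteSpace K]
  [NormedAddCommGroup K'] [InnerProductSpace ℂ K'] [CompleteSpace K']

theorem OrthogonalRanges.adjoint_apply {R : Fin n → K →L[ℂ] K} (h : OrthogonalRanges R)
    {i j : Fin n} (hij : i ≠ j) (y : K) : (R i).adjoint (R j y) = 0 := by
  refine ext_inner_left ℂ fun x => ?_
  rw [ContinuousLinearMap.adjoint_inner_right, h i j hij, inner_zero_right]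

variable {A : Matrix (Fin n) (Fin n) ℂ} {T : Fin n → H →L[ℂ] H}
  {J : H →ₗᵢ[ℂ] K} {R : Fin n → K →L[ℂ] K} {J' : H →ₗᵢ[ℂ] K'} {R' : Fin n → K' →L[ℂ] K'}

theorem IsDilation.inner_wordOp_right (h : IsDilation T J R) (α : List (Fin n)) (a b : H) :
    ⟪J a, wordOp R α (J b)⟫_ℂ = ⟪a, wordOp T α b⟫_ℂ := by
  induction α generalizing a with
  | nil => simp [wordOp_nil]
  | cons i α ih =>
    rw [wordOp_cons, wordOp_cons, ← ContinuousLinearMap.adjoint_inner_left, h, ih,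
      ContinuousLinearMap.adjoint_inner_left]

/-- The vector `R m w` is fixed by the range projection of `R m` and killed by the other ones, so
only the term `j = m` of the sum for `(R i)^* R i` survives. -/
theorem IsMinimalCuntzKriegerDilation.adjoint_apply_apply_same
    (h : IsMinimalCuntzKriegerDilation A T J R) (i m : Fin n) (w : K) :
    (R i).adjoint (R i (R m w)) = A i m • R m w := by
  obtain ⟨-, hP, hO, -, hC⟩ := h
  have h1 := DFunLike.congr_fun (hC i) (R m w)
  have h2 := DFunLike.congr_fun (hP m) w
  simp only [ContinuousLinearMap.comp_apply] at h2
  simp only [ContinuousLinearMap.comp_apply, _root_.sub_apply,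
    _root_.sum_apply, _root_.smul_apply,
    ContinuousLinearMap.id_apply] at h1
  rw [h1, Finset.sum_eq_single m, h2]
  · module
  · intro j _ hj
    rw [hO.adjoint_apply hj, map_zero, smul_zero]
  · simp

theorem IsMinimalCuntzKriegerDilation.adjoint_apply_apply_embedding
    (h : IsMinimalCuntzKriegerDilation A T J R) (i : Fin n) (b : H) :
    (R i).adjoint (R i (J b)) = J b - ∑ j, (1 - A i j) • R j (J ((T j).adjoint b)) := by
  have h1 := DFunLike.congr_fun (h.2.2.2.2 i) (J b)
  simp only [ContinuousLinearMap.comp_apply, _root_.sub_apply,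
    _root_.sum_apply, _root_.smul_apply,
    ContinuousLinearMap.id_apply] at h1
  simp only [h1, h.1.1 _ b]

/-- Distinct first letters give zero. Equal ones are stripped by moving `R i` across the inner
product, where `(R i)^* R i` produces only words applied to `H`, with coefficients depending on `A`
and `T`. -/
theorem IsMinimalCuntzKriegerDilation.inner_wordOp_eq
    (h : IsMinimalCuntzKriegerDilation A T J R) (h' : IsMinimalCuntzKriegerDilation A T J' R')
    (α β : List (Fin n)) (a b : H) :
    ⟪wordOp R α (J a), wordOp R β (J b)⟫_ℂ = ⟪wordOp R' α (J' a), wordOp R' β (J' b)⟫_ℂ := by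
  have key : ∀ (β : List (Fin n)) (b : H),
      ⟪J a, wordOp R β (J b)⟫_ℂ = ⟪J' a, wordOp R' β (J' b)⟫_ℂ := fun β b => by
    rw [h.1.1.inner_wordOp_right, h'.1.1.inner_wordOp_right]
  induction α generalizing β b with
  | nil => exact key β b
  | cons i α ih =>
    cases β with
    | nil =>
      rw [← inner_conj_symm, ← inner_conj_symm (wordOp R' _ _), wordOp_nil, wordOp_nil,
        h.1.1.inner_wordOp_right, h'.1.1.inner_wordOp_right]
    | cons j β =>
      simp only [wordOp_cons]
      by_cases hij : i = j
      · subst hij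
        rw [← ContinuousLinearMap.adjoint_inner_right (R i),
          ← ContinuousLinearMap.adjoint_inner_right (R' i)]
        cases β with
        | nil =>
          simp only [wordOp_nil, h.adjoint_apply_apply_embedding, h'.adjoint_apply_apply_embedding,
            inner_sub_right, inner_sum, inner_smul_right]
          -- Applying `(R i)^* R i` to a vector of `H` leaves words of length zero and one. The
          -- right-hand word may thus grow, so the induction runs on the left-hand word for all `β`
          -- and `b`.
          have h0 := ih [] b
          have h1 : ∀ m c, _ = _ := fun m c => ih [m] c
          simp only [wordOp_cons, wordOp_nil] at h0 h1
          simp only [h0, h1]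
        | cons m β =>
          have h1 := ih (m :: β) b
          simp only [wordOp_cons] at h1
          simp only [wordOp_cons, h.adjoint_apply_apply_same, h'.adjoint_apply_apply_same,
            inner_smul_right, h1]
      · rw [h.2.2.1 i j hij, h'.2.2.1 i j hij]

theorem IsMinimalDilation.span_range_eq_top (h : IsMinimalDilation T J R) :
    (Submodule.span ℂ (Set.range fun p : List (Fin n) × H =>
      wordOp R p.1 (J p.2))).topologicalClosure = ⊤ := by
  rw [← h.2]
  congr 2
  ext x
  simp [eq_comm]

/-- The minimal Cuntz–Krieger dilation is unique up to unitary equivalence over `H`. -/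
theorem IsMinimalCuntzKriegerDilation.unitarilyEquivalentOver
    (h : IsMinimalCuntzKriegerDilation A T J R) (h' : IsMinimalCuntzKriegerDilation A T J' R') :
    UnitarilyEquivalentOver J R J' R' := by
  obtain ⟨U, hU⟩ := exists_linearIsometryEquiv_of_inner_eq _ _ h.1.span_range_eq_top
    h'.1.span_range_eq_top fun p q => h.inner_wordOp_eq h' p.1 q.1 p.2 q.2
  refine ⟨U, fun a => hU ([], a), fun i => ?_⟩
  have heq : (U : K →L[ℂ] K') ∘L R i = R' i ∘L (U : K →L[ℂ] K') := by
    refine ContinuousLinearMap.ext_on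
      (Submodule.dense_iff_topologicalClosure_eq_top.2 h.1.span_range_eq_top) ?_
    rintro _ ⟨⟨α, a⟩, rfl⟩
    have h1 := hU (i :: α, a)
    simp only [wordOp_cons] at h1
    simpa [hU (α, a)] using h1
  exact fun x => DFunLike.congr_fun heq x

end Uniqueness

/-! ### Compressions to the maximal subspace -/

section Piece

variable {n : ℕ} {K I : Type*} [NormedAddCommGroup K] [InnerProductSpace ℂ K] [CompleteSpace K]

theorem adjoint_mem_maximalSubspace {V : Fin n → K →L[ℂ] K} {p : I → FreeAlgebra ℂ (Fin n)}
    (i : Fin n) {x : K} (hx : x ∈ maximalSubspace V p) :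
    (V i).adjoint x ∈ maximalSubspace V p :=
  (isGreatest_maximalSubspace V p).1.2.1 i x hx

/-- The vectors meeting both conditions form a closed subspace containing the maximal one. Its
adjoint images lie in the maximal one, so it belongs to the family and cannot be larger. -/
theorem mem_maximalSubspace_of_adjoint_mem {V : Fin n → K →L[ℂ] K}
    {p : I → FreeAlgebra ℂ (Fin n)} {x : K}
    (hx : ∀ i, (V i).adjoint x ∈ maximalSubspace V p)
    (hp : ∀ ξ, (polyEval V (p ξ)).adjoint x = 0) : x ∈ maximalSubspace V p := by
  have hM := isGreatest_maximalSubspace V p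
  let M : Submodule ℂ K :=
    (⨅ i, (maximalSubspace V p).comap ((V i).adjoint : K →ₗ[ℂ] K)) ⊓
      ⨅ ξ, LinearMap.ker ((polyEval V (p ξ)).adjoint : K →ₗ[ℂ] K)
  have hmem : ∀ y, y ∈ M ↔ (∀ i, (V i).adjoint y ∈ maximalSubspace V p) ∧
      ∀ ξ, (polyEval V (p ξ)).adjoint y = 0 := fun y => by
    simp [M, Submodule.mem_iInf]
  have hle : maximalSubspace V p ≤ M := fun y hy =>
    (hmem y).2 ⟨fun i => hM.1.2.1 i y hy, fun ξ => hM.1.2.2 ξ y hy⟩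
  have hfam : M ∈ pieceFamily V p := by
    refine ⟨?_, fun i y hy => hle (((hmem y).1 hy).1 i), fun ξ y hy => ((hmem y).1 hy).2 ξ⟩
    have hset : (M : Set K) = (⋂ i, (V i).adjoint ⁻¹' (maximalSubspace V p : Set K)) ∩
        ⋂ ξ, (polyEval V (p ξ)).adjoint ⁻¹' {0} := by
      ext y
      simpa using hmem y
    rw [hset]
    exact (isClosed_iInter fun i => hM.1.1.preimage (V i).adjoint.continuous).inter
      (isClosed_iInter fun ξ => isClosed_singleton.preimage (polyEval V (p ξ)).adjoint.continuous)
  exact hM.2 hfam ((hmem x).2 ⟨hx, hp⟩)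

theorem coe_adjoint_maximalPiece (V : Fin n → K →L[ℂ] K) (p : I → FreeAlgebra ℂ (Fin n))
    (i : Fin n) (x : maximalSubspace V p) :
    ((maximalPiece V p i).adjoint x : K) = (V i).adjoint x := by
  have h : (maximalPiece V p i).adjoint x = ⟨_, adjoint_mem_maximalSubspace i x.2⟩ := by
    refine ext_inner_right ℂ fun y => ?_
    rw [ContinuousLinearMap.adjoint_inner_left]
    simp only [maximalPiece, ContinuousLinearMap.comp_apply, Submodule.subtypeL_apply]
    rw [Submodule.inner_orthogonalProjectionOnto_eq_of_mem_left, Submodule.coe_inner,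
      ContinuousLinearMap.adjoint_inner_left]
  rw [h]

theorem coe_maximalPiece_eq_of_sub_mem_orthogonal {V : Fin n → K →L[ℂ] K}
    {p : I → FreeAlgebra ℂ (Fin n)} {i : Fin n} {x : maximalSubspace V p} {y : K}
    (hy : y ∈ maximalSubspace V p) (hxy : V i x - y ∈ (maximalSubspace V p)ᗮ) :
    (maximalPiece V p i x : K) = y := by
  have h := Submodule.orthogonalProjectionOnto_apply_of_mem_orthogonal hxy
  rw [map_sub, sub_eq_zero] at h
  simp only [maximalPiece, ContinuousLinearMap.comp_apply, Submodule.subtypeL_apply, h]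
  simpa using congrArg Subtype.val
    (Submodule.orthogonalProjectionOnto_mem_subspace_eq_self (⟨y, hy⟩ : maximalSubspace V p))

/-- This is the adjoint of the fact that `(V i)^*` maps the subspace into itself. -/
theorem orthogonalProjectionOnto_apply_eq_maximalPiece (V : Fin n → K →L[ℂ] K)
    (p : I → FreeAlgebra ℂ (Fin n)) (i : Fin n) (x : K) :
    (maximalSubspace V p).orthogonalProjectionOnto (V i x) =
      maximalPiece V p i ((maximalSubspace V p).orthogonalProjectionOnto x) := by
  refine ext_inner_left ℂ fun y => ?_
  rw [← ContinuousLinearMap.adjoint_inner_left (maximalPiece V p i),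
    Submodule.inner_orthogonalProjectionOnto_eq_of_mem_left,
    Submodule.inner_orthogonalProjectionOnto_eq_of_mem_left, coe_adjoint_maximalPiece,
    ContinuousLinearMap.adjoint_inner_left]

theorem orthogonalProjectionOnto_wordOp (V : Fin n → K →L[ℂ] K)
    (p : I → FreeAlgebra ℂ (Fin n)) (α : List (Fin n)) (x : K) :
    (maximalSubspace V p).orthogonalProjectionOnto (wordOp V α x) =
      wordOp (maximalPiece V p) α ((maximalSubspace V p).orthogonalProjectionOnto x) := by
  induction α with
  | nil => rfl
  | cons i α ih =>
    rw [wordOp_cons, wordOp_cons, orthogonalProjectionOnto_apply_eq_maximalPiece, ih]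

/-- A minimal dilation restricts to a minimal dilation on the maximal piece. -/
theorem IsMinimalDilation.maximalPiece {H : Type*} [NormedAddCommGroup H] [InnerProductSpace ℂ H]
    [CompleteSpace H] {T : Fin n → H →L[ℂ] H} {J : H →ₗᵢ[ℂ] K} {V : Fin n → K →L[ℂ] K}
    (h : IsMinimalDilation T J V) {p : I → FreeAlgebra ℂ (Fin n)}
    {J₀ : H →ₗᵢ[ℂ] maximalSubspace V p} (hJ₀ : ∀ a, (J₀ a : K) = J a) :
    IsMinimalDilation T J₀ (maximalPiece V p) := by
  refine ⟨fun i a => Subtype.ext ?_, ?_⟩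
  · rw [coe_adjoint_maximalPiece, hJ₀, hJ₀, h.1]
  have hd := Submodule.dense_iff_topologicalClosure_eq_top.2 h.2
  rw [← Submodule.dense_iff_topologicalClosure_eq_top]
  -- A continuous surjection maps a dense set to a dense set, and the projection sends `V^α a` to
  -- the same word in the piece.
  have hsurj : Function.Surjective (maximalSubspace V p).orthogonalProjectionOnto := fun y =>
    ⟨y, Submodule.orthogonalProjectionOnto_mem_subspace_eq_self y⟩
  have him := hsurj.denseRange.dense_image
    (maximalSubspace V p).orthogonalProjectionOnto.continuous hd
  refine him.mono ?_
  rintro _ ⟨x, hx, rfl⟩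
  rw [SetLike.mem_coe] at hx ⊢
  induction hx using Submodule.span_induction with
  | mem x hx =>
    obtain ⟨α, a, rfl⟩ := hx
    refine Submodule.subset_span ⟨α, a, ?_⟩
    rw [orthogonalProjectionOnto_wordOp, ← hJ₀,
      Submodule.orthogonalProjectionOnto_mem_subspace_eq_self]
  | zero => simp
  | add x y _ _ hx hy => rw [map_add]; exact add_mem hx hy
  | smul c x _ hx => rw [map_smul]; exact Submodule.smul_mem _ c hx

theorem polyEval_aRelationPoly_adjoint_eq_zero_iff {A : Matrix (Fin n) (Fin n) ℂ}
    (hA : IsZeroOne A) (V : Fin n → K →L[ℂ] K) (k l : Fin n) (x : K) :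
    (polyEval V (aRelationPoly A (k, l))).adjoint x = 0 ↔
      (A k l = 0 → (V l).adjoint ((V k).adjoint x) = 0) := by
  have h : polyEval V (aRelationPoly A (k, l)) = V k ∘L V l - A k l • (V k ∘L V l) := by
    simp [polyEval, aRelationPoly, ContinuousLinearMap.mul_def]
  rw [h]
  rcases hA k l with h0 | h0 <;> simp [h0, ContinuousLinearMap.adjoint_comp]

end Piece

/-! ### The Cuntz–Krieger relations on the maximal piece -/

section APiece

variable {n : ℕ} {K : Type*} [NormedAddCommGroup K] [InnerProductSpace ℂ K] [CompleteSpace K]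
  {A : Matrix (Fin n) (Fin n) ℂ} {V : Fin n → K →L[ℂ] K}

theorem adjoint_adjoint_eq_zero (hA : IsZeroOne A) {x : K} (hx : x ∈ maximalASubspace A V)
    {k l : Fin n} (hkl : A k l = 0) : (V l).adjoint ((V k).adjoint x) = 0 :=
  (polyEval_aRelationPoly_adjoint_eq_zero_iff hA V k l x).1
    ((isGreatest_maximalSubspace V (aRelationPoly A)).1.2.2 (k, l) x hx) hkl

theorem mem_maximalASubspace_of_adjoint_mem (hA : IsZeroOne A) {x : K}
    (hx : ∀ i, (V i).adjoint x ∈ maximalASubspace A V)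
    (hr : ∀ k l, A k l = 0 → (V l).adjoint ((V k).adjoint x) = 0) :
    x ∈ maximalASubspace A V :=
  mem_maximalSubspace_of_adjoint_mem hx fun ξ =>
    (polyEval_aRelationPoly_adjoint_eq_zero_iff hA V ξ.1 ξ.2 x).2 (hr ξ.1 ξ.2)

/-- The space of an `A`-relation tuple is contained in the maximal `A`-relation subspace of each
of its dilations. -/
theorem IsDilation.mem_maximalASubspace {H : Type*} [NormedAddCommGroup H] [InnerProductSpace ℂ H]
    [CompleteSpace H] {T : Fin n → H →L[ℂ] H} {J : H →ₗᵢ[ℂ] K} (h : IsDilation T J V)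
    (hA : IsZeroOne A) (hT : SatisfiesARelations A T) (a : H) : J a ∈ maximalASubspace A V := by
  have hfam : LinearMap.range J.toLinearMap ∈ pieceFamily V (aRelationPoly A) := by
    refine ⟨?_, ?_, ?_⟩
    · rw [LinearMap.coe_range]
      exact J.isometry.isClosedEmbedding.isClosed_range
    · rintro i _ ⟨b, rfl⟩
      exact ⟨(T i).adjoint b, (h i b).symm⟩
    · rintro ⟨k, l⟩ _ ⟨b, rfl⟩
      rw [polyEval_aRelationPoly_adjoint_eq_zero_iff hA]
      intro hkl
      have hTT : T k ∘L T l = 0 := by rw [hT k l, hkl, zero_smul]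
      have h1 : (T l).adjoint ((T k).adjoint b) = 0 := by
        rw [← ContinuousLinearMap.comp_apply, ← ContinuousLinearMap.adjoint_comp, hTT]
        simp
      simp [h k b, h l, h1]
  exact (isGreatest_maximalSubspace V (aRelationPoly A)).2 hfam ⟨a, rfl⟩

theorem adjoint_apply_self_of_isometry {W : K →L[ℂ] K} (hW : Isometry W) (x : K) :
    W.adjoint (W x) = x :=
  DFunLike.congr_fun ((ContinuousLinearMap.isometry_iff_adjoint_comp_self W).1 hW) x

theorem apply_adjoint_mem_maximalASubspace (hA : IsZeroOne A) (hV : ∀ i, Isometry (V i))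
    (hO : OrthogonalRanges V) (j : Fin n) {x : K} (hx : x ∈ maximalASubspace A V) :
    V j ((V j).adjoint x) ∈ maximalASubspace A V := by
  refine mem_maximalASubspace_of_adjoint_mem hA (fun k => ?_) fun k l hkl => ?_
  · by_cases hk : k = j
    · subst hk
      rw [adjoint_apply_self_of_isometry (hV k)]
      exact adjoint_mem_maximalSubspace k hx
    · rw [hO.adjoint_apply hk]
      exact zero_mem _
  · by_cases hk : k = j
    · subst hk
      rw [adjoint_apply_self_of_isometry (hV k), adjoint_adjoint_eq_zero hA hx hkl]
    · rw [hO.adjoint_apply hk, map_zero]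

/-- The projection of `x` onto the complement of the ranges of those `V j` with `A i j = 0`. -/
noncomputable def allowedPart (A : Matrix (Fin n) (Fin n) ℂ) (V : Fin n → K →L[ℂ] K) (i : Fin n)
    (x : K) : K :=
  x - ∑ j, (1 - A i j) • V j ((V j).adjoint x)

theorem allowedPart_mem (hA : IsZeroOne A) (hV : ∀ i, Isometry (V i))
    (hO : OrthogonalRanges V) (i : Fin n) {x : K} (hx : x ∈ maximalASubspace A V) :
    allowedPart A V i x ∈ maximalASubspace A V :=
  sub_mem hx (sum_mem fun j _ => Submodule.smul_mem _ _
    (apply_adjoint_mem_maximalASubspace hA hV hO j hx))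

theorem adjoint_allowedPart (hV : ∀ i, Isometry (V i)) (hO : OrthogonalRanges V) (i l : Fin n)
    (x : K) : (V l).adjoint (allowedPart A V i x) = A i l • (V l).adjoint x := by
  rw [allowedPart, map_sub, map_sum, Finset.sum_eq_single l]
  · rw [map_smul, adjoint_apply_self_of_isometry (hV l)]
    module
  · intro j _ hj
    rw [map_smul, hO.adjoint_apply hj.symm, smul_zero]
  · simp

/-- The adjoints `(V k)^*` return the allowed part for `k = i` and zero otherwise. The relations
hold because `(V l)^*` kills the allowed part when `A i l = 0`. -/
theorem apply_allowedPart_mem (hA : IsZeroOne A) (hV : ∀ i, Isometry (V i))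
    (hO : OrthogonalRanges V) (i : Fin n) {x : K} (hx : x ∈ maximalASubspace A V) :
    V i (allowedPart A V i x) ∈ maximalASubspace A V := by
  refine mem_maximalASubspace_of_adjoint_mem hA (fun k => ?_) fun k l hkl => ?_
  · by_cases hk : k = i
    · subst hk
      rw [adjoint_apply_self_of_isometry (hV k)]
      exact allowedPart_mem hA hV hO k hx
    · rw [hO.adjoint_apply hk]
      exact zero_mem _
  · by_cases hk : k = i
    · subst hk
      rw [adjoint_apply_self_of_isometry (hV k), adjoint_allowedPart hV hO, hkl, zero_smul]
    · rw [hO.adjoint_apply hk, map_zero]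

theorem coe_maximalAPiece (hA : IsZeroOne A) (hV : ∀ i, Isometry (V i))
    (hO : OrthogonalRanges V) (i : Fin n) (x : maximalASubspace A V) :
    (maximalAPiece A V i x : K) = V i (allowedPart A V i x) := by
  refine coe_maximalPiece_eq_of_sub_mem_orthogonal (apply_allowedPart_mem hA hV hO i x.2) ?_
  rw [← map_sub, allowedPart, sub_sub_cancel, map_sum]
  refine sum_mem fun j _ => ?_
  rw [Submodule.mem_orthogonal]
  intro y hy
  rw [map_smul, inner_smul_right, ← ContinuousLinearMap.adjoint_inner_left,
    ← ContinuousLinearMap.adjoint_inner_left]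
  -- If `A i j = 0`, the relation satisfied by `y` gives orthogonality; otherwise the coefficient
  -- vanishes.
  rcases hA i j with h0 | h0
  · rw [adjoint_adjoint_eq_zero hA hy h0, inner_zero_left, mul_zero]
  · rw [h0, sub_self, zero_mul]

/-- Nothing is deleted from `(V i)^* x`: the relations on the subspace already make its components
with `A i j = 0` vanish. -/
theorem maximalAPiece_apply_adjoint (hA : IsZeroOne A) (hV : ∀ i, Isometry (V i))
    (hO : OrthogonalRanges V) (i : Fin n) (x : maximalASubspace A V) :
    (maximalAPiece A V i ((maximalAPiece A V i).adjoint x) : K) = V i ((V i).adjoint x) := by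
  rw [coe_maximalAPiece hA hV hO, coe_adjoint_maximalPiece, allowedPart, Finset.sum_eq_zero,
    sub_zero]
  intro j _
  rcases hA i j with h0 | h0
  · rw [adjoint_adjoint_eq_zero hA x.2 h0, map_zero, smul_zero]
  · rw [h0, sub_self, zero_smul]

/-- The maximal `A`-relation piece of the minimal isometric dilation is a minimal Cuntz–Krieger
dilation. -/
theorem IsMinimalIsometricDilation.maximalAPiece {H : Type*} [NormedAddCommGroup H]
    [InnerProductSpace ℂ H] [CompleteSpace H] {T : Fin n → H →L[ℂ] H} {J : H →ₗᵢ[ℂ] K}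
    (h : IsMinimalIsometricDilation T J V) (hA : IsZeroOne A)
    {J₀ : H →ₗᵢ[ℂ] maximalASubspace A V} (hJ₀ : ∀ a, (J₀ a : K) = J a) :
    IsMinimalCuntzKriegerDilation A T J₀ (maximalAPiece A V) := by
  obtain ⟨hmin, hV, hO⟩ := h
  refine ⟨hmin.maximalPiece hJ₀, fun i => ?_, fun i j hij x y => ?_, fun i j => ?_, fun i => ?_⟩
  · ext x
    simp only [ContinuousLinearMap.comp_apply]
    rw [maximalAPiece_apply_adjoint hA hV hO, coe_maximalAPiece hA hV hO,
      adjoint_apply_self_of_isometry (hV i)]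
  · rw [Submodule.coe_inner, coe_maximalAPiece hA hV hO, coe_maximalAPiece hA hV hO, hO i j hij]
  · rcases hA i j with h0 | h0
    · rw [h0, zero_smul]
      refine ContinuousLinearMap.ext fun x => ext_inner_left ℂ fun y => ?_
      rw [ContinuousLinearMap.comp_apply, ← ContinuousLinearMap.adjoint_inner_left,
        ← ContinuousLinearMap.adjoint_inner_left, Submodule.coe_inner, coe_adjoint_maximalPiece,
        coe_adjoint_maximalPiece, adjoint_adjoint_eq_zero hA y.2 h0]
      simp
    · rw [h0, one_smul]
  · ext x
    simp only [ContinuousLinearMap.comp_apply, _root_.sub_apply,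
      _root_.sum_apply, _root_.smul_apply, ContinuousLinearMap.id_apply,
      Submodule.coe_sub, Submodule.coe_sum, Submodule.coe_smul]
    rw [coe_adjoint_maximalPiece, coe_maximalAPiece hA hV hO,
      adjoint_apply_self_of_isometry (hV i), allowedPart]
    simp only [maximalAPiece_apply_adjoint hA hV hO]

end APiece

end CKDilation

theorem theorem14 {n : ℕ} (A : Matrix (Fin n) (Fin n) ℂ) (hA : CKDilation.IsZeroOne A)
    {H : Type*} [NormedAddCommGroup H] [InnerProductSpace ℂ H] [CompleteSpace H]
    (T : Fin n → H →L[ℂ] H) (hT : CKDilation.IsARelationTuple A T)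
    {K : Type*} [NormedAddCommGroup K] [InnerProductSpace ℂ K] [CompleteSpace K]
    (J : H →ₗᵢ[ℂ] K) (V : Fin n → K →L[ℂ] K)
    (hV : CKDilation.IsMinimalIsometricDilation T J V) :
    ∃ J₀ : H →ₗᵢ[ℂ] CKDilation.maximalASubspace A V,
      (∀ h, (J₀ h : K) = J h) ∧
      CKDilation.IsMinimalCuntzKriegerDilation A T J₀ (CKDilation.maximalAPiece A V) ∧
      ∀ (K' : Type*) [NormedAddCommGroup K'] [InnerProductSpace ℂ K'] [CompleteSpace K']
        (J' : H →ₗᵢ[ℂ] K') (R : Fin n → K' →L[ℂ] K'),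
        CKDilation.IsMinimalCuntzKriegerDilation A T J' R →
          CKDilation.UnitarilyEquivalentOver J' R J₀ (CKDilation.maximalAPiece A V) := by
  let J₀ : H →ₗᵢ[ℂ] CKDilation.maximalASubspace A V :=
    { toLinearMap := J.toLinearMap.codRestrict _
        fun a => hV.1.1.mem_maximalASubspace hA hT.2 a
      norm_map' := J.norm_map }
  have hJ₀ : ∀ a, (J₀ a : K) = J a := fun _ => rfl
  have hCK := hV.maximalAPiece hA hJ₀
  exact ⟨J₀, hJ₀, hCK, fun K' _ _ _ J' R hR => hR.unitarilyEquivalentOver hCK⟩
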